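/- Let $\psi:\{1,2,\dots\}\to(-1,\infty)$ be any function with $\psi(k)\to 0$ as $k\to\infty$. Put $w(k)=\dfrac{1+\psi(k)}{k^{5/2}}$ and $p(k)=w(k)\big/\sum_{\ell\ge1}w(\ell)$ for $k\ge 1$. Let $\xi_1,\xi_2,\dots$ be independent random variables with $\mathbb P(\xi_i=k)=p(k)$ for all $k\ge 1$, let $S_k=\xi_1+\dots+\xi_k$, and let $\nu=\mathbb E[\xi_1]$. Let $r$ and $N$ be positive integer-valued functions of $n\in\{1,2,\dots\}$ such that $r(n)=o(n)$ as $n\to\infty$ and, with $m(n)=n-r(n)$, for all sufficiently large $n$ one has $r(n)>(\ln n)^{25}$ and $1\le N(n)\le m(n)$. If $$\limsup_{n\to\infty}\frac{\nu N(n)}{m(n)}<1,$$ then, as $n\to\infty$, $$\mathbb P\Big(\max_{1\le i\le N(n)}\xi_i\le\frac{m(n)}{(\ln n)^2}\ \Big|\ S_{N(n)}=m(n)\Big)=O\big(n^{-10}\big).$$ The above applies in particular to quadrangulations: if $|\mathcal Q_k|=\dfrac{2\cdot 3^{k-2}}{(k-1)k}\dbinom{2(k-2)}{k-2}$ for $k\ge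 2$ (by Tutte's formula, the number of rooted quadrangulations with $k$ vertices), then the function $\psi$ determined by $|\mathcal Q_{k+1}|=\dfrac{2}{\sqrt\pi}\,\dfrac{12^{k-1}(1+\psi(k))}{k^{5/2}}$ for $k\ge 1$ satisfies $\psi(k)>-1$ for all $k\ge1$ and $\psi(k)\to0$. -/

import Mathlib

open Filter Topology MeasureTheory ProbabilityTheory Asymptotics

noncomputable section

/-- The number of rooted quadrangulations with `k ≥ 2` vertices (equivalently `k - 2` faces), by
Tutte's formula `|Q_k| = 2 * 3 ^ n / ((n + 1) * (n + 2)) * (2n choose n)` with `n = k - 2`.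
A single edge is the quadrangulation with two vertices. -/
def rootedQuadCount (k : ℕ) : ℝ :=
  2 * 3 ^ (k - 2) / (((k - 2 : ℕ) + 1 : ℝ) * ((k - 2 : ℕ) + 2 : ℝ)) * (k - 2).centralBinom

/-- The function `ψ` determined, for `k ≥ 1`, by
`|Q_{k+1}| = (2 / √π) * 12 ^ (k - 1) * (1 + ψ k) / k ^ (5/2)`. -/
def quadPsi (k : ℕ) : ℝ :=
  rootedQuadCount (k + 1) * (k : ℝ) ^ (5 / 2 : ℝ) * √Real.pi / (2 * 12 ^ (k - 1)) - 1

/-- The functions `ψ : {1, 2, …} → (-1, ∞)` with `ψ k → 0` as `k → ∞` (the value `ψ 0` is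
never used). -/
def IsCorrection (ψ : ℕ → ℝ) : Prop :=
  (∀ k, 1 ≤ k → -1 < ψ k) ∧ Tendsto ψ atTop (𝓝 0)

/-- The weight `w k = (1 + ψ k) / k ^ (5/2)` for `k ≥ 1`; there is no mass at `0`. -/
def boxWeight (ψ : ℕ → ℝ) (k : ℕ) : ℝ :=
  if k = 0 then 0 else (1 + ψ k) / (k : ℝ) ^ (5 / 2 : ℝ)

/-- The probabilities `p k = w k / ∑ ℓ, w ℓ`. -/
def boxProb (ψ : ℕ → ℝ) (k : ℕ) : ℝ :=
  boxWeight ψ k / ∑' l, boxWeight ψ l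

/-- `ξ 0, ξ 1, …` are independent random variables with `P (ξ i = k) = p k`. -/
structure IsBoxSequence {Ω : Type*} [MeasurableSpace Ω] (P : Measure Ω) (ψ : ℕ → ℝ)
    (ξ : ℕ → Ω → ℕ) : Prop where
  measurable : ∀ i, Measurable (ξ i)
  indep : iIndepFun ξ P
  law : ∀ i k, P.real {ω | ξ i ω = k} = boxProb ψ k

end

/-! The conditional probability is at most a ratio. Choose `c < 1` eventually bounding `ν N / m`. In
the numerator, truncating at `B = m / (log n)^2` permits a Chernoff bound with `t` of order `log n /
m`: since `t B → 0`, each factor is at most `exp ((1 + δ) t ν)`, and the gap `1 - c` beats the small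
`δ`, giving `n^(-13)` (`measureReal_sum_eq_and_sup_le_le_exp`). The denominator is only polynomially
small: by Markov all summands but the last total less than `m` with probability at least `1 - c`,
and the last fills the gap with probability at least a constant times `n^(-3)`
(`le_measureReal_sum_range_succ_eq`). The quotient is `O(n^(-10))`. For quadrangulations, `ψ → 0` is
Stirling's formula for the central binomial coefficient. -/

/-! ### Asymptotics of the quadrangulation counts -/

/-- The expression equals `stirlingSeq (2 * n) / stirlingSeq n ^ 2`, whose limit is `√π / π`. -/
theorem tendsto_centralBinom_mul_sqrt_div_four_pow :
    Tendsto (fun n : ℕ => (n.centralBinom : ℝ) * √n / 4 ^ n) atTop (𝓝 (√Real.pi)⁻¹) := by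
  have hpi : √Real.pi ≠ 0 := by positivity
  have h := Stirling.tendsto_stirlingSeq_sqrt_pi
  have h2 : Tendsto (fun n : ℕ => Stirling.stirlingSeq (2 * n)) atTop (𝓝 √Real.pi) :=
    h.comp (tendsto_id.const_mul_atTop' (by norm_num : 0 < 2))
  have h3 := h2.div (h.pow 2) (pow_ne_zero 2 hpi)
  have e : √Real.pi / √Real.pi ^ 2 = (√Real.pi)⁻¹ := by field_simp
  rw [e] at h3
  refine h3.congr' ?_
  filter_upwards [eventually_gt_atTop 0] with n hn
  have hn' : (0 : ℝ) < n := by exact_mod_cast hn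
  have hcb : ((2 * n).factorial : ℝ) = n.centralBinom * n.factorial ^ 2 := by
    have := Nat.choose_mul_factorial_mul_factorial (show n ≤ 2 * n by omega)
    rw [show 2 * n - n = n by omega] at this
    rw [← this, Nat.centralBinom]
    push_cast
    ring
  have hf : (n.factorial : ℝ) ≠ 0 := by positivity
  have hs : √(2 * (2 * n : ℝ)) = 2 * √n := by
    rw [show (2 * (2 * n : ℝ)) = 2 ^ 2 * n by ring, Real.sqrt_mul (by norm_num),
      Real.sqrt_sq (by norm_num)]
  have hs2 : √(2 * (n : ℝ)) ^ 2 = 2 * n := Real.sq_sqrt (by positivity)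
  have hs3 : √(n : ℝ) ^ 2 = n := Real.sq_sqrt (by positivity)
  have hs0 : √(n : ℝ) ≠ 0 := by positivity
  have hp : (2 * (n : ℝ) / Real.exp 1) ^ (2 * n) = 4 ^ n * ((n / Real.exp 1) ^ n) ^ 2 := by
    rw [mul_div_assoc, mul_pow, pow_mul, ← pow_mul _ n 2, mul_comm n 2]
    norm_num
  have hq : ((n : ℝ) / Real.exp 1) ^ n ≠ 0 := by positivity
  simp only [Stirling.stirlingSeq, Pi.div_apply]
  push_cast
  rw [hcb, hs, hp, div_pow (n.factorial : ℝ), mul_pow (√(2 * (n : ℝ))), hs2]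
  generalize ((n : ℝ) / Real.exp 1) ^ n = q at hq ⊢
  field_simp
  linear_combination (-(n.centralBinom : ℝ)) * hs3

/-- Isolates the Stirling factor; the remaining rational and square-root factors tend to 1. -/
theorem quadPsi_succ {j : ℕ} (h : 0 < j) :
    quadPsi (j + 1) = (j.centralBinom * √(j : ℝ) / 4 ^ j) * √Real.pi
      * (((j + 1 : ℝ) / j) ^ (1 / 2 : ℝ) * ((j + 1 : ℝ) / (j + 2))) - 1 := by
  have hj : (0 : ℝ) < j := by exact_mod_cast h
  have h52 : ((j + 1 : ℝ)) ^ (5 / 2 : ℝ) = (j + 1) ^ 2 * √(j + 1 : ℝ) := by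
    rw [Real.sqrt_eq_rpow, ← Real.rpow_natCast, ← Real.rpow_add (by positivity)]
    norm_num
  have h12 : (12 : ℝ) ^ j = 3 ^ j * 4 ^ j := by rw [← mul_pow]; norm_num
  have hs0 : √(j : ℝ) ≠ 0 := by positivity
  simp only [quadPsi, rootedQuadCount, show j + 1 + 1 - 2 = j by omega, Nat.add_sub_cancel]
  push_cast
  rw [h52, h12, ← Real.sqrt_eq_rpow, Real.sqrt_div (by positivity)]
  field_simp

theorem tendsto_quadPsi : Tendsto quadPsi atTop (𝓝 0) := by
  rw [← tendsto_add_atTop_iff_nat 1]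
  have hpi : √Real.pi ≠ 0 := by positivity
  have h1 : Tendsto (fun j : ℕ => ((j + 1 : ℝ) / j)) atTop (𝓝 1) := by
    have := (tendsto_natCast_div_add_atTop (1 : ℝ)).inv₀ one_ne_zero
    simpa using this
  have h2 : Tendsto (fun j : ℕ => ((j + 1 : ℝ) / (j + 2))) atTop (𝓝 1) := by
    have := (tendsto_add_atTop_iff_nat 1).2 (tendsto_natCast_div_add_atTop (1 : ℝ))
    refine this.congr fun j => ?_
    push_cast
    ring
  have h3 := h1.rpow_const (p := (1 / 2 : ℝ)) (Or.inl one_ne_zero)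
  have h := ((tendsto_centralBinom_mul_sqrt_div_four_pow.mul_const √Real.pi).mul
    (h3.mul h2)).sub_const 1
  simp only [Real.one_rpow, inv_mul_cancel₀ hpi, mul_one, sub_self] at h
  refine h.congr' ?_
  filter_upwards [eventually_gt_atTop 0] with j hj
  exact (quadPsi_succ hj).symm

theorem isCorrection_quadPsi : IsCorrection quadPsi := by
  refine ⟨fun k hk => ?_, tendsto_quadPsi⟩
  have hk' : (0 : ℝ) < k := by exact_mod_cast hk
  have hc : (0 : ℝ) < (k + 1 - 2).centralBinom := by exact_mod_cast Nat.centralBinom_pos _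
  have : 0 < rootedQuadCount (k + 1) * (k : ℝ) ^ (5 / 2 : ℝ) * √Real.pi / (2 * 12 ^ (k - 1)) := by
    unfold rootedQuadCount
    positivity
  unfold quadPsi
  linarith

/-! ### Moments and lower bounds for the box law -/

section Weights

variable {ψ : ℕ → ℝ}

theorem boxWeight_nonneg (hψ : IsCorrection ψ) (k : ℕ) : 0 ≤ boxWeight ψ k := by
  unfold boxWeight
  split_ifs with h
  · rfl
  · have := hψ.1 k (Nat.one_le_iff_ne_zero.2 h)
    have : 0 ≤ 1 + ψ k := by linarith
    positivity

/-- Eventually `1 + ψ k ≤ 2`, so the terms are dominated by `2 / k ^ (3/2)`. This finite mean is the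
only moment the proof needs. -/
theorem summable_mul_boxWeight (hψ : IsCorrection ψ) :
    Summable fun k : ℕ => (k : ℝ) * boxWeight ψ k := by
  have hs : Summable fun k : ℕ => 1 / (k : ℝ) ^ (3 / 2 : ℝ) :=
    Real.summable_one_div_nat_rpow.2 (by norm_num)
  refine summable_of_isBigO_nat (hs.mul_left 2) (IsBigO.of_bound 1 ?_)
  filter_upwards [eventually_gt_atTop 0,
    hψ.2.eventually (eventually_le_nhds (show (0 : ℝ) < 1 by norm_num))] with k hk h1
  have hk' : (0 : ℝ) < k := by exact_mod_cast hk
  have h0 := boxWeight_nonneg hψ k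
  rw [one_mul, Real.norm_of_nonneg (by positivity), Real.norm_of_nonneg (by positivity),
    boxWeight, if_neg hk.ne', show (5 / 2 : ℝ) = 3 / 2 + 1 by norm_num, Real.rpow_add hk',
    Real.rpow_one]
  have : (k : ℝ) * ((1 + ψ k) / ((k : ℝ) ^ (3 / 2 : ℝ) * k))
      = (1 + ψ k) * (1 / (k : ℝ) ^ (3 / 2 : ℝ)) := by field_simp
  rw [this]
  gcongr
  linarith

theorem summable_boxWeight (hψ : IsCorrection ψ) : Summable (boxWeight ψ) := by
  refine (summable_mul_boxWeight hψ).of_nonneg_of_le (boxWeight_nonneg hψ) fun k => ?_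
  rcases Nat.eq_zero_or_pos k with rfl | hk
  · simp [boxWeight]
  · have : (1 : ℝ) ≤ k := by exact_mod_cast hk
    exact le_mul_of_one_le_left (boxWeight_nonneg hψ k) this

theorem tsum_boxWeight_pos (hψ : IsCorrection ψ) : 0 < ∑' l, boxWeight ψ l := by
  refine (summable_boxWeight hψ).tsum_pos (boxWeight_nonneg hψ) 1 ?_
  have := hψ.1 1 le_rfl
  simp [boxWeight]
  linarith

theorem boxProb_nonneg (hψ : IsCorrection ψ) (k : ℕ) : 0 ≤ boxProb ψ k :=
  div_nonneg (boxWeight_nonneg hψ k) (tsum_boxWeight_pos hψ).le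

theorem summable_mul_boxProb (hψ : IsCorrection ψ) :
    Summable fun k : ℕ => (k : ℝ) * boxProb ψ k := by
  simpa only [boxProb, mul_div_assoc] using (summable_mul_boxWeight hψ).div_const _

/-- The tail is at least `1/2`, and the finitely many earlier values have a positive minimum. -/
theorem exists_pos_le_one_add (hψ : IsCorrection ψ) :
    ∃ δ > 0, ∀ k, 1 ≤ k → δ ≤ 1 + ψ k := by
  obtain ⟨K, hK⟩ := eventually_atTop.1
    (hψ.2.eventually (eventually_ge_nhds (show (-(1 / 2) : ℝ) < 0 by norm_num)))
  have key : ∀ M : ℕ, ∃ δ > 0, ∀ k, 1 ≤ k → k < M → δ ≤ 1 + ψ k := by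
    intro M
    induction M with
    | zero => exact ⟨1, one_pos, by simp⟩
    | succ M ih =>
      obtain ⟨δ, hδ, h⟩ := ih
      rcases Nat.eq_zero_or_pos M with rfl | hM
      · exact ⟨1, one_pos, fun k h1 h2 => by omega⟩
      refine ⟨min δ (1 + ψ M), lt_min hδ (by linarith [hψ.1 M hM]), fun k h1 h2 => ?_⟩
      rcases Nat.lt_succ_iff_lt_or_eq.1 h2 with h3 | rfl
      · exact (min_le_left _ _).trans (h k h1 h3)
      · exact min_le_right _ _
  obtain ⟨δ, hδ, h⟩ := key K
  refine ⟨min δ (1 / 2), lt_min hδ (by norm_num), fun k h1 => ?_⟩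
  rcases lt_or_ge k K with h3 | h3
  · exact (min_le_left _ _).trans (h k h1 h3)
  · exact (min_le_right _ _).trans (by linarith [hK k h3])

theorem exists_pos_div_rpow_le_boxProb (hψ : IsCorrection ψ) :
    ∃ δ > 0, ∀ k : ℕ, 1 ≤ k → δ / (k : ℝ) ^ (5 / 2 : ℝ) ≤ boxProb ψ k := by
  obtain ⟨δ, hδ, h⟩ := exists_pos_le_one_add hψ
  have hZ := tsum_boxWeight_pos hψ
  refine ⟨δ / ∑' l, boxWeight ψ l, div_pos hδ hZ, fun k hk => ?_⟩
  rw [boxProb, boxWeight, if_neg (by omega), div_right_comm]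
  gcongr
  exact h k hk

end Weights

/-! ### Upper and lower bounds for sums of boxes -/

section Sums

variable {Ω : Type*} [MeasurableSpace Ω] {P : Measure Ω} {ψ : ℕ → ℝ} {ξ : ℕ → Ω → ℕ}

theorem IsBoxSequence.integrable [IsProbabilityMeasure P] (hψ : IsCorrection ψ)
    (h : IsBoxSequence P ψ ξ) (i : ℕ) : Integrable (fun ω => (ξ i ω : ℝ)) P := by
  have hm := h.measurable i
  refine ⟨by fun_prop, ?_⟩
  have e : ∫⁻ ω, ‖(ξ i ω : ℝ)‖ₑ ∂P = ∑' k : ℕ, ENNReal.ofReal (k * boxProb ψ k) := by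
    rw [← lintegral_map (f := fun k : ℕ => ‖(k : ℝ)‖ₑ) (by fun_prop) hm, lintegral_countable']
    refine tsum_congr fun k => ?_
    rw [Measure.map_apply hm (measurableSet_singleton k), ENNReal.ofReal_mul (by positivity),
      ← h.law i k, Measure.real, ENNReal.ofReal_toReal (measure_ne_top _ _),
      Real.enorm_of_nonneg (by positivity)]
    rfl
  rw [HasFiniteIntegral, e, ← ENNReal.ofReal_tsum_of_nonneg
    (fun k => mul_nonneg (by positivity) (boxProb_nonneg hψ k)) (summable_mul_boxProb hψ)]
  exact ENNReal.ofReal_lt_top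

theorem IsBoxSequence.integral_eq [IsProbabilityMeasure P]
    (h : IsBoxSequence P ψ ξ) (i : ℕ) : ∫ ω, (ξ i ω : ℝ) ∂P = ∫ ω, (ξ 0 ω : ℝ) ∂P := by
  have hi : IdentDistrib (ξ i) (ξ 0) P P :=
    { aemeasurable_fst := (h.measurable i).aemeasurable
      aemeasurable_snd := (h.measurable 0).aemeasurable
      map_eq := by
        refine Measure.ext_of_singleton fun k => ?_
        rw [Measure.map_apply (h.measurable i) (measurableSet_singleton k),
          Measure.map_apply (h.measurable 0) (measurableSet_singleton k)]
        exact (measureReal_eq_measureReal_iff).1 ((h.law i k).trans (h.law 0 k).symm) }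
  exact (hi.comp (measurable_from_top (f := fun k : ℕ => (k : ℝ)))).integral_eq

/-- The exponential Markov inequality for a sum whose summands are all at most `B`. -/
theorem measureReal_sum_eq_and_sup_le_le_exp [IsProbabilityMeasure P]
    (hm : ∀ i, Measurable (ξ i)) (hindep : iIndepFun ξ P) {ν : ℝ}
    (hint : ∀ i, Integrable (fun ω => (ξ i ω : ℝ)) P) (hν : ∀ i, ∫ ω, (ξ i ω : ℝ) ∂P = ν)
    (N m : ℕ) {B t δ : ℝ} (hB : 0 ≤ B) (ht : 0 ≤ t) (hδ : δ ≤ 1) (htB : t * B ≤ δ) :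
    P.real {ω | ∑ i ∈ Finset.range N, ξ i ω = m ∧
        (((Finset.range N).sup fun i => ξ i ω : ℕ) : ℝ) ≤ B}
      ≤ Real.exp (-t * m + N * ((1 + δ) * t * ν)) := by
  -- On the event considered `Y i = ξ i`, and boundedness supplies the exponential moments that the
  -- heavy-tailed `ξ i` lack.
  let Y : ℕ → Ω → ℝ := fun i ω => min (ξ i ω : ℝ) B
  have hY0 : ∀ i ω, 0 ≤ Y i ω := fun i ω => le_min (by positivity) hB
  have hYm : ∀ i, Measurable (Y i) := fun i => by have := hm i; fun_prop
  have hYi : iIndepFun Y P :=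
    hindep.comp (fun _ k => min (k : ℝ) B) fun _ => measurable_from_top
  have hexp : ∀ i ω, Real.exp (t * Y i ω) ≤ 1 + (1 + δ) * t * ξ i ω := fun i ω => by
    have hx0 : 0 ≤ t * Y i ω := mul_nonneg ht (hY0 i ω)
    have hx1 : t * Y i ω ≤ δ :=
      (mul_le_mul_of_nonneg_left (min_le_right _ _) ht).trans htB
    have hx2 : t * Y i ω ≤ t * ξ i ω := mul_le_mul_of_nonneg_left (min_le_left _ _) ht
    -- For `0 ≤ x ≤ δ ≤ 1`: `exp x ≤ 1 + x + x ^ 2 ≤ 1 + (1 + δ) x`.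
    have := (abs_le.1 (Real.abs_exp_sub_one_sub_id_le
      (abs_le.2 ⟨by linarith, hx1.trans hδ⟩))).2
    nlinarith
  have hmgf : ∀ i, mgf (Y i) P t ≤ Real.exp ((1 + δ) * t * ν) := fun i => by
    calc mgf (Y i) P t ≤ ∫ ω, (1 + (1 + δ) * t * ξ i ω) ∂P :=
          integral_mono_of_nonneg (ae_of_all _ fun _ => (Real.exp_pos _).le)
            ((integrable_const _).add ((hint i).const_mul _)) (ae_of_all _ (hexp i))
      _ = (1 + δ) * t * ν + 1 := by
          rw [integral_add (integrable_const _) ((hint i).const_mul _), integral_const_mul, hν]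
          simp [add_comm]
      _ ≤ _ := Real.add_one_le_exp _
  have hsum_le : ∀ ω, (∑ i ∈ Finset.range N, Y i) ω ≤ N * B := fun ω => by
    rw [Finset.sum_apply]
    calc _ ≤ ∑ i ∈ Finset.range N, B := Finset.sum_le_sum fun i _ => min_le_right _ _
      _ = _ := by simp
  have hSm : Measurable (∑ i ∈ Finset.range N, Y i) := by fun_prop
  have hI : Integrable (fun ω => Real.exp (t * (∑ i ∈ Finset.range N, Y i) ω)) P := by
    refine Integrable.of_bound (C := Real.exp (t * (N * B)))
      (by fun_prop) (ae_of_all _ fun ω => ?_)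
    rw [Real.norm_of_nonneg (Real.exp_pos _).le, Real.exp_le_exp]
    exact mul_le_mul_of_nonneg_left (hsum_le ω) ht
  calc _ ≤ P.real {ω | (m : ℝ) ≤ (∑ i ∈ Finset.range N, Y i) ω} := by
        refine measureReal_mono fun ω hω => ?_
        obtain ⟨h1, h2⟩ := hω
        have : ∀ i ∈ Finset.range N, Y i ω = ξ i ω := fun i hi => by
          refine min_eq_left (le_trans ?_ h2)
          exact_mod_cast Finset.le_sup (f := fun i => ξ i ω) hi
        rw [Set.mem_ofPred_eq, Finset.sum_apply, Finset.sum_congr rfl this, ← h1]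
        push_cast
        rfl
    _ ≤ Real.exp (-t * m) * mgf (∑ i ∈ Finset.range N, Y i) P t :=
        measure_ge_le_exp_mul_mgf _ ht hI
    _ ≤ Real.exp (-t * m) * ∏ i ∈ Finset.range N, Real.exp ((1 + δ) * t * ν) := by
        rw [hYi.mgf_sum hYm]
        gcongr with i _
        · exact fun i _ => mgf_nonneg
        · exact hmgf i
    _ = _ := by rw [Finset.prod_const, Finset.card_range, ← Real.exp_nat_mul, ← Real.exp_add]

/-- A lower bound for the local probability of a sum: all summands but the last add up to less
than `m`, and the last one supplies the difference. -/
theorem le_measureReal_sum_range_succ_eq [IsProbabilityMeasure P]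
    (hm : ∀ i, Measurable (ξ i)) (hindep : iIndepFun ξ P) {ν : ℝ}
    (hint : ∀ i, Integrable (fun ω => (ξ i ω : ℝ)) P) (hν : ∀ i, ∫ ω, (ξ i ω : ℝ) ∂P = ν)
    (N m : ℕ) {c q : ℝ} (hm0 : 0 < m) (hc : N * ν ≤ c * m) (hq0 : 0 ≤ q)
    (hq : ∀ k, 1 ≤ k → k ≤ m → q ≤ P.real {ω | ξ N ω = k}) :
    (1 - c) * q ≤ P.real {ω | ∑ i ∈ Finset.range (N + 1), ξ i ω = m} := by
  let S : Ω → ℕ := fun ω => ∑ i ∈ Finset.range N, ξ i ω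
  have hS : Measurable S := Finset.measurable_fun_sum _ fun i _ => hm i
  have hm' : (0 : ℝ) < m := by exact_mod_cast hm0
  have hind : IndepFun S (ξ N) P := by
    have := hindep.indepFun_finsetSum_of_notMem hm (Finset.notMem_range_self (n := N))
    convert this using 1
    ext ω
    simp [S]
  have hES : ∫ ω, (S ω : ℝ) ∂P = N * ν := by
    simp only [S, Nat.cast_sum]
    rw [integral_finsetSum _ fun i _ => hint i]
    simp [hν]
  have hSint : Integrable (fun ω => (S ω : ℝ)) P := by
    simp only [S, Nat.cast_sum]
    exact integrable_finsetSum _ fun i _ => hint i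
  have hmarkov : P.real {ω | m ≤ S ω} ≤ c := by
    have := mul_meas_ge_le_integral_of_nonneg (ae_of_all P fun ω => Nat.cast_nonneg' (S ω)) hSint m
    rw [hES] at this
    simp only [Nat.cast_le] at this
    nlinarith
  have hlt : 1 - c ≤ P.real {ω | S ω < m} := by
    have := probReal_compl_eq_one_sub (μ := P) (s := {ω | m ≤ S ω})
      (measurableSet_le measurable_const hS)
    have e : {ω | m ≤ S ω}ᶜ = {ω | S ω < m} := by ext; simp
    rw [e] at this
    linarith
  have hset : {ω | S ω < m} = ⋃ j ∈ Finset.range m, {ω | S ω = j} := by ext; simp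
  -- Since `j < m`, the gap `m - j` lies in `[1, m]`, where `q` bounds the law of the last summand
  -- from below.
  have hsub : (⋃ j ∈ Finset.range m, {ω | S ω = j} ∩ {ω | ξ N ω = m - j})
      ⊆ {ω | ∑ i ∈ Finset.range (N + 1), ξ i ω = m} := by
    intro ω hω
    simp only [Set.mem_iUnion, Finset.mem_range, Set.mem_inter_iff, Set.mem_ofPred_eq] at hω
    obtain ⟨j, hj, h1, h2⟩ := hω
    rw [Set.mem_ofPred_eq, Finset.sum_range_succ]
    change S ω + ξ N ω = m
    omega
  have hmS : ∀ j, MeasurableSet {ω | S ω = j} := fun j => hS (measurableSet_singleton j)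
  have hmξ : ∀ j, MeasurableSet {ω | ξ N ω = j} := fun j => hm N (measurableSet_singleton j)
  have hdisj : ∀ i j : ℕ, i ≠ j → Disjoint {ω | S ω = i} {ω | S ω = j} := fun i j hij =>
    Set.disjoint_left.2 fun ω h1 h2 => hij (h1.symm.trans h2)
  calc (1 - c) * q ≤ P.real {ω | S ω < m} * q := by gcongr
    _ = ∑ j ∈ Finset.range m, P.real {ω | S ω = j} * q := by
        rw [hset, measureReal_biUnion_finset (fun i _ j _ hij => hdisj i j hij)
          (fun j _ => hmS j), Finset.sum_mul]
    _ ≤ ∑ j ∈ Finset.range m, P.real {ω | S ω = j} * P.real {ω | ξ N ω = m - j} := by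
        refine Finset.sum_le_sum fun j hj => ?_
        have := Finset.mem_range.1 hj
        gcongr
        exact hq _ (by omega) (by omega)
    _ = ∑ j ∈ Finset.range m, P.real ({ω | S ω = j} ∩ {ω | ξ N ω = m - j}) := by
        refine Finset.sum_congr rfl fun j _ => ?_
        rw [Measure.real, Measure.real, Measure.real, ← ENNReal.toReal_mul]
        congr 1
        exact (hind.measure_inter_preimage_eq_mul {j} {m - j} (measurableSet_singleton _)
          (measurableSet_singleton _)).symm
    _ = P.real (⋃ j ∈ Finset.range m, {ω | S ω = j} ∩ {ω | ξ N ω = m - j}) :=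
        (measureReal_biUnion_finset (fun i _ j _ hij => (hdisj i j hij).mono
          Set.inter_subset_left Set.inter_subset_left)
          (fun j _ => (hmS j).inter (hmξ _))).symm
    _ ≤ _ := measureReal_mono hsub

end Sums

/-! ### Choice of parameters and conclusion -/

theorem proposition3p1 :
    IsCorrection quadPsi ∧
    ∀ (ψ : ℕ → ℝ), IsCorrection ψ →
    ∀ {Ω : Type*} [MeasurableSpace Ω] (P : Measure Ω) [IsProbabilityMeasure P]
      (ξ : ℕ → Ω → ℕ), IsBoxSequence P ψ ξ →
    ∀ (r m N : ℕ → ℕ),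
      (∀ᶠ n : ℕ in atTop, Real.log n ^ 25 < r n) →
      ((fun n => (r n : ℝ)) =o[atTop] fun n => (n : ℝ)) →
      (∀ᶠ n in atTop, m n + r n = n) →
      (∀ᶠ n in atTop, 1 ≤ N n ∧ N n ≤ m n) →
      limsup (fun n => (∫ ω, (ξ 0 ω : ℝ) ∂P) * N n / m n) atTop < 1 →
      (fun n => (P[|{ω | ∑ i ∈ Finset.range (N n), ξ i ω = m n}]).real
          {ω | (((Finset.range (N n)).sup fun i => ξ i ω : ℕ) : ℝ) ≤ m n / Real.log n ^ 2})
        =O[atTop] fun n : ℕ => ((n : ℝ) ^ 10)⁻¹ := by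
  refine ⟨isCorrection_quadPsi, fun ψ hψ Ω _ P _ ξ hξ r m N _ _ hmr hN hlim => ?_⟩
  set ν : ℝ := ∫ ω, (ξ 0 ω : ℝ) ∂P with hνdef
  have hν0 : 0 ≤ ν := integral_nonneg fun _ => Nat.cast_nonneg' _
  have hint := hξ.integrable hψ
  -- A real `limsup` carries information only for a bounded sequence; `N ≤ m` supplies the bound
  -- `ν`.
  have hbdd : IsBoundedUnder (· ≤ ·) atTop fun n => ν * N n / m n := by
    refine isBoundedUnder_of_eventually_le (a := ν) ?_
    filter_upwards [hN] with n hn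
    have h1 : (N n : ℝ) ≤ m n := by exact_mod_cast hn.2
    rw [mul_div_assoc]
    exact mul_le_of_le_one_right hν0 (div_le_one_of_le₀ h1 (by positivity))
  obtain ⟨c, hc, hc1⟩ := exists_between (max_lt hlim one_pos)
  have hc0 : 0 < c := (le_max_right _ _).trans_lt hc
  have hlt := eventually_lt_of_limsup_lt ((le_max_left _ _).trans_lt hc) hbdd
  obtain ⟨q, hq, hqp⟩ := exists_pos_div_rpow_le_boxProb hψ
  have hlog : Tendsto (fun n : ℕ => Real.log n) atTop atTop :=
    Real.tendsto_log_atTop.comp tendsto_natCast_atTop_atTop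
  refine IsBigO.of_bound ((1 - c) * q)⁻¹ ?_
  filter_upwards [hN, hmr, hlt, hlog.eventually_gt_atTop 0, eventually_ge_atTop 1,
    -- This threshold says exactly that `t B = 26 / ((1 - c) log n) ≤ δ`, with `δ = (1 - c) / 2`.
    hlog.eventually_ge_atTop (26 / (1 - c) / ((1 - c) / 2))] with n hNn hmrn hltn hlogn hn hAn
  have h1c : 0 < 1 - c := by linarith
  have hm0 : 0 < m n := by omega
  have hm0' : (0 : ℝ) < m n := by exact_mod_cast hm0
  have hmn : (m n : ℝ) ≤ n := by exact_mod_cast (by omega : m n ≤ n)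
  have hn1 : (1 : ℝ) ≤ n := by exact_mod_cast hn
  have hνN : ν * N n ≤ c * m n := ((div_lt_iff₀ hm0').1 hltn).le
  have hnum := measureReal_sum_eq_and_sup_le_le_exp hξ.measurable hξ.indep hint hξ.integral_eq
    (N n) (m n) (B := m n / Real.log n ^ 2) (t := 26 / (1 - c) * Real.log n / m n)
    (δ := (1 - c) / 2) (by positivity) (by positivity) (by linarith) (by
      have : 26 / (1 - c) * Real.log n / m n * (m n / Real.log n ^ 2)
          = 26 / (1 - c) / Real.log n := by field_simp
      rw [this, div_le_iff₀ hlogn]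
      exact (div_le_iff₀' (by positivity)).1 hAn)
  rw [← hνdef] at hnum
  -- As `1 - (1 + δ) c = (1 - c) (1 - c / 2) ≥ (1 - c) / 2`, the factor 26 in `t` leaves an exponent
  -- of at most `-13 log n`.
  have hexp : -(26 / (1 - c) * Real.log n / m n) * m n
      + N n * ((1 + (1 - c) / 2) * (26 / (1 - c) * Real.log n / m n) * ν)
      ≤ -((13 : ℕ) * Real.log n) := by
    set t := 26 / (1 - c) * Real.log n / m n with ht
    have ht0 : 0 ≤ t := by positivity
    have htm : t * m n * (1 - c) = 26 * Real.log n := by rw [ht]; field_simp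
    have h1 : N n * ((1 + (1 - c) / 2) * t * ν) ≤ (1 + (1 - c) / 2) * t * (c * m n) := by
      calc _ = (1 + (1 - c) / 2) * t * (ν * N n) := by ring
        _ ≤ _ := by gcongr
    have h2 : 0 ≤ t * m n * (1 - c) * (1 - c) := by positivity
    push_cast
    nlinarith
  have hnum' := hnum.trans (Real.exp_le_exp.2 hexp)
  rw [Real.exp_neg, Real.exp_nat_mul, Real.exp_log (by positivity)] at hnum'
  have hden : (1 - c) * (q / (n : ℝ) ^ 3)
      ≤ P.real {ω | ∑ i ∈ Finset.range (N n), ξ i ω = m n} := by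
    obtain ⟨M, hM⟩ : ∃ M, N n = M + 1 := ⟨N n - 1, by omega⟩
    rw [hM]
    refine le_measureReal_sum_range_succ_eq hξ.measurable hξ.indep hint hξ.integral_eq M (m n) hm0
      ?_ (by positivity) fun k hk1 hkm => ?_
    · rw [hM] at hνN
      push_cast at hνN
      linarith
    · rw [hξ.law]
      refine le_trans ?_ (hqp k hk1)
      have hk0 : (0 : ℝ) < k := by exact_mod_cast hk1
      have hkn : (k : ℝ) ≤ n := by exact_mod_cast (by omega : k ≤ n)
      gcongr
      -- Rounding `5/2` up to 3 costs nothing: 13 was chosen so that `13 - 3 = 10`.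
      calc (k : ℝ) ^ (5 / 2 : ℝ) ≤ (n : ℝ) ^ (5 / 2 : ℝ) := by gcongr
        _ ≤ (n : ℝ) ^ ((3 : ℕ) : ℝ) := Real.rpow_le_rpow_of_exponent_le hn1 (by norm_num)
        _ = (n : ℝ) ^ 3 := Real.rpow_natCast _ _
  have hms : MeasurableSet {ω | ∑ i ∈ Finset.range (N n), ξ i ω = m n} :=
    (Finset.measurable_fun_sum _ fun i _ => hξ.measurable i) (measurableSet_singleton (m n))
  rw [Real.norm_of_nonneg measureReal_nonneg, Real.norm_of_nonneg (by positivity),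
    Measure.real, cond_apply hms, ENNReal.toReal_mul, ENNReal.toReal_inv]
  calc _ ≤ ((1 - c) * (q / (n : ℝ) ^ 3))⁻¹ * ((n : ℝ) ^ 13)⁻¹ := by
        gcongr
        · exact hden
        · exact hnum'
    _ = _ := by field_simp
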